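/- Let $1\le s\le d$ be integers and consider the hypercubic lattice $\mathbb L^d=(\mathbb Z^d,\mathbb E^d)$, where $\mathbb E^d$ is the set of pairs $\{x,y\}\subset\mathbb Z^d$ with $\|x-y\|_1=1$. Let $H=\mathbb Z^s\times\{0\}^{d-s}$. For $p,q\in[0,1]$, let $P_{p,q}$ be the law on $\{0,1\}^{\mathbb E^d}$ under which the edges are open independently of each other, each edge with both endpoints in $H$ being open with probability $q$ and every other edge being open with probability $p$. Let $\{o\leftrightarrow\infty\}$ be the event that the set of vertices joined to the origin by open paths is infinite, and define $q_c\colon[0,1]\to[0,1]$ by $$q_c(p)=\sup\{q\in[0,1] : P_{p,q}(o\leftrightarrow\infty)=0\},$$ with the convention $\sup\emptyset=0$. Then the function $p\mapsto q_c(p)$ is continuous at $p=0$. -/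

import Mathlib

open MeasureTheory ProbabilityTheory unitInterval

namespace DefectPercolation

/-- The hypercubic lattice `𝕃^d`: vertex set `ℤ^d`, with an edge between `x` and `y` exactly when
their `L¹` distance is `1`. -/
def lattice (d : ℕ) : SimpleGraph (Fin d → ℤ) where
  Adj x y := ∑ i, |x i - y i| = 1
  symm := ⟨fun x y h => by simpa only [abs_sub_comm] using h⟩
  loopless := ⟨fun x h => by simp at h⟩

/-- The sublattice of defects `H = ℤ^s × {0}^(d-s)`. -/
def sublattice (d s : ℕ) : Set (Fin d → ℤ) :=
  {x | ∀ i : Fin d, s ≤ (i : ℕ) → x i = 0}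

/-- Percolation configurations on `𝕃^d`: `true` means open and `false` means closed. The
σ-algebra is the product one, generated by the finite-dimensional cylinders. -/
abbrev Config (d : ℕ) : Type := (lattice d).edgeSet → Bool

open scoped Classical in
/-- The opening probability of an edge: `q` if both of its endpoints are in `H`, and `p`
otherwise. -/
noncomputable def edgeProb (d s : ℕ) (p q : I) (e : (lattice d).edgeSet) : I :=
  if ∀ v ∈ (e : Sym2 (Fin d → ℤ)), v ∈ sublattice d s then q else p

/-- The measure `P_{p,q}`: edges are independent, edge `e` is open with probability
`edgeProb d s p q e`. -/
noncomputable def percMeasure (d s : ℕ) (p q : I) : Measure (Config d) :=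
  Measure.infinitePi fun e => bernoulliMeasure true false (edgeProb d s p q e)

/-- The subgraph of `𝕃^d` formed by the open edges of `ω`. -/
def openGraph {d : ℕ} (ω : Config d) : SimpleGraph (Fin d → ℤ) :=
  SimpleGraph.fromEdgeSet {e | ∃ h : e ∈ (lattice d).edgeSet, ω ⟨e, h⟩ = true}

/-- The cluster of `u`: all vertices joined to `u` by an open path (including `u` itself). -/
def cluster {d : ℕ} (ω : Config d) (u : Fin d → ℤ) : Set (Fin d → ℤ) :=
  {v | (openGraph ω).Reachable u v}

/-- The event `{u ↔ ∞}` that the cluster of `u` is infinite. -/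
def percolates {d : ℕ} (u : Fin d → ℤ) : Set (Config d) :=
  {ω | (cluster ω u).Infinite}

/-- The critical parameter function
`q_c(p) = sup {q ∈ [0,1] : P_{p,q}(o ↔ ∞) = 0}` (equal to `0` if the set is empty). -/
noncomputable def criticalParam (d s : ℕ) (p : I) : ℝ :=
  sSup {x : ℝ | ∃ q : I, (q : ℝ) = x ∧ percMeasure d s p q (percolates 0) = 0}

/-- The critical parameter function takes values in `[0,1]`. -/
theorem criticalParam_mem (d s : ℕ) (p : I) : criticalParam d s p ∈ Set.Icc (0 : ℝ) 1 := by
  constructor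
  · apply Real.sSup_nonneg
    rintro x ⟨q, rfl, -⟩
    exact q.2.1
  · apply Real.sSup_le
    · rintro x ⟨q, rfl, -⟩
      exact q.2.2
    · exact zero_le_one

end DefectPercolation

/-! The upper bound is global: at `p = 0` almost every configuration has no open edge outside `H`,
so percolation there is percolation inside `H`, whose law does not depend on `p`. Hence `q_c(p) ≤
q_c(0)` for every `p` (`criticalParam_le_zero`).

The lower bound follows Duminil-Copin and Tassion. For a finite set `S` containing `x`,
`boundaryFlux` is the mean number of open edges leaving `S` from vertices joined to `x` within `S`.
Two facts make the value `1` critical. (1) If every vertex has some `S` with flux at most `c < 1`,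
then `sup_x θ(x) ≤ c * sup_x θ(x)` for the percolation probabilities `θ(x)`, so they all vanish
(`percMeasure_percolates_eq_zero`). (2) If at `p = 0` every flux of the origin is at least `1` for
all `q` in a nondegenerate interval, Russo's formula gives `f' ≥ 1 - f` for the probability `f` of
leaving a box, uniformly in the box, so the origin percolates at the upper end
(`percMeasure_percolates_ne_zero`).

Given `a < q_c(0)`, take a nonpercolating `q₁ > a`. By (2), some parameter `t` in `(a, q₁]` has a
finite `S` with flux below `1` at `p = 0`. This flux is a polynomial in `p`, so it stays below `1`
for small `p`. Translates of `S` serve all vertices of `H`; a vertex off `H` uses its singleton,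
whose flux is `O(p)`. Now (1) rules out percolation at `(p, t)`, and `q_c(p) ≥ t > a`. -/

namespace DefectPercolation

/-! ### Inhomogeneous Bernoulli product measures and Russo's formula. -/

section Bernoulli

variable {ι : Type*}

/-- The product of Bernoulli measures with parameters `r`. -/
noncomputable abbrev bern (r : ι → I) : Measure (ι → Bool) :=
  Measure.infinitePi fun e => bernoulliMeasure true false (r e)

open scoped Classical in
/-- Set all coordinates outside of `T` to `false`. -/
noncomputable def mask (T : Set ι) (ω : ι → Bool) : ι → Bool :=
  fun i => if i ∈ T then ω i else false

lemma mask_apply_of_mem {T : Set ι} {i : ι} (h : i ∈ T) (ω : ι → Bool) : mask T ω i = ω i := by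
  simp [mask, h]

lemma mem_iff_of_dependsOn {A : Set (ι → Bool)} {T : Set ι} (hA : DependsOn (· ∈ A) T)
    {ω ω' : ι → Bool} (h : ∀ i ∈ T, ω i = ω' i) : ω ∈ A ↔ ω' ∈ A :=
  iff_of_eq (hA h)

lemma dependsOn_of_imp {A : Set (ι → Bool)} {T : Set ι}
    (h : ∀ ω ω' : ι → Bool, (∀ i ∈ T, ω i = ω' i) → ω ∈ A → ω' ∈ A) :
    DependsOn (· ∈ A) T := fun ω ω' hω =>
  propext ⟨h ω ω' hω, h ω' ω fun i hi => (hω i hi).symm⟩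

lemma dependsOn_inter {A B : Set (ι → Bool)} {T : Set ι} (hA : DependsOn (· ∈ A) T)
    (hB : DependsOn (· ∈ B) T) : DependsOn (· ∈ A ∩ B) T :=
  dependsOn_of_imp fun _ _ h hω =>
    ⟨(mem_iff_of_dependsOn hA h).1 hω.1, (mem_iff_of_dependsOn hB h).1 hω.2⟩

lemma preimage_mask {A : Set (ι → Bool)} {T : Set ι} (hA : DependsOn (· ∈ A) T) :
    mask T ⁻¹' A = A := by
  ext ω
  exact mem_iff_of_dependsOn hA fun i hi => mask_apply_of_mem hi ω

/-- `A` is its own preimage under `mask T`, which is measurable for the σ-algebra of the coordinates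
in `T`. No finiteness of `T` is needed, so events about infinite clusters are covered. -/
lemma measurableSet_iSup_of_dependsOn {A : Set (ι → Bool)} {T : Set ι}
    (hA : DependsOn (· ∈ A) T) (mA : MeasurableSet A) :
    MeasurableSet[⨆ i ∈ T, MeasurableSpace.comap (fun ω : ι → Bool => ω i) ⊤] A := by
  rw [← preimage_mask hA]
  suffices h : @Measurable _ _ (⨆ i ∈ T, MeasurableSpace.comap (fun ω : ι → Bool => ω i) ⊤)
    _ (mask T) from h mA
  refine (@measurable_pi_iff _ _ _ (_) _ _).2 fun i => ?_
  by_cases hi : i ∈ T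
  · simp only [mask, hi, if_true]
    have h : MeasurableSpace.comap (fun ω : ι → Bool => ω i) ⊤ ≤
      ⨆ i ∈ T, MeasurableSpace.comap (fun ω : ι → Bool => ω i) ⊤ :=
      le_iSup₂ (f := fun i (_ : i ∈ T) => MeasurableSpace.comap (fun ω : ι → Bool => ω i) ⊤) i hi
    exact (comap_measurable _).mono h le_rfl
  · simp only [mask, hi, if_false]
    exact @measurable_const _ _ _ _ _

/-- Events depending on disjoint sets of coordinates are independent. -/
lemma bern_inter_of_disjoint (r : ι → I) {A B : Set (ι → Bool)} {S T : Set ι}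
    (hST : Disjoint S T) (hA : DependsOn (· ∈ A) S) (hB : DependsOn (· ∈ B) T)
    (mA : MeasurableSet A) (mB : MeasurableSet B) :
    bern r (A ∩ B) = bern r A * bern r B := by
  have h : iIndepFun (fun i (ω : ι → Bool) => ω i) (bern r) :=
    iIndepFun_infinitePi (X := fun _ b => b) fun _ => measurable_id
  have h' := indep_iSup_of_disjoint (fun i => (measurable_pi_apply i).comap_le) h.iIndep hST
  exact (Indep_iff _ _ _).1 h' A B (measurableSet_iSup_of_dependsOn hA mA)
    (measurableSet_iSup_of_dependsOn hB mB)

lemma bern_congr {r r' : ι → I} {A : Set (ι → Bool)} {T : Set ι} (hr : ∀ i ∈ T, r i = r' i)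
    (hA : DependsOn (· ∈ A) T) (mA : MeasurableSet A) : bern r A = bern r' A := by
  classical
  let g : (T → Bool) → ι → Bool := fun η i => if h : i ∈ T then η ⟨i, h⟩ else false
  have hg : Measurable g := by
    refine measurable_pi_lambda _ fun i => ?_
    by_cases hi : i ∈ T
    · simpa only [g, hi, dite_true] using measurable_pi_apply _
    · simpa only [g, hi, dite_false] using measurable_const
  have hA' : A = T.domRestrict ⁻¹' (g ⁻¹' A) := by
    rw [← Set.preimage_comp]
    conv_lhs => rw [← preimage_mask hA]
    congr 1
  have hm : Measurable (T.domRestrict : (ι → Bool) → _) := by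
    exact measurable_pi_lambda _ fun i => measurable_pi_apply _
  rw [hA', ← Measure.map_apply hm (hg mA), ← Measure.map_apply hm (hg mA),
    Measure.infinitePi_map_restrict', Measure.infinitePi_map_restrict']
  congr 2
  ext1 i
  rw [hr i i.2]

/-- The probability of a Boolean value under the Bernoulli law of parameter `x`. -/
def weight (x : ℝ) (b : Bool) : ℝ := if b then x else 1 - x

open scoped Classical in
/-- Extend a finite configuration by `false`. -/
noncomputable def ext (F : Finset ι) (η : F → Bool) : ι → Bool :=
  fun i => if h : i ∈ F then η ⟨i, h⟩ else false

open scoped Classical in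
/-- The probability of an event that depends only on the coordinates in `F`, as a polynomial in
the parameters. -/
noncomputable def bernPoly (F : Finset ι) (A : Set (ι → Bool)) (x : ι → ℝ) : ℝ :=
  ∑ η : F → Bool, if ext F η ∈ A then ∏ e : F, weight (x e) (η e) else 0

/-- Passing to polynomials in real parameters makes differentiation and continuity available without
staying inside `[0,1]`. -/
lemma bern_real_eq_bernPoly (r : ι → I) {F : Finset ι} {A : Set (ι → Bool)}
    (hA : DependsOn (· ∈ A) (F : Set ι)) : (bern r).real A = bernPoly F A fun e => r e := by
  classical
  have hA' : A = F.restrict ⁻¹' {η : F → Bool | ext F η ∈ A} := by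
    ext ω
    refine mem_iff_of_dependsOn hA fun i hi => ?_
    have hi' : i ∈ F := hi
    simp [ext, hi']
  have hm : MeasurableSet {η : F → Bool | ext F η ∈ A} := Set.Finite.measurableSet (Set.toFinite _)
  have hr : Measurable (F.restrict : (ι → Bool) → F → Bool) := by fun_prop
  have h1 : (bern r).real A = ((bern r).map F.restrict).real {η : F → Bool | ext F η ∈ A} := by
    rw [map_measureReal_apply hr hm, ← hA']
  rw [h1, Measure.infinitePi_map_restrict, bernPoly, ← Finset.sum_filter]
  have h2 : {η : F → Bool | ext F η ∈ A} = ↑(Finset.univ.filter fun η : F → Bool => ext F η ∈ A) := by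
    simp
  rw [h2, ← sum_measureReal_singleton]
  refine Finset.sum_congr rfl fun η _ => ?_
  rw [measureReal_def, ← Set.univ_pi_singleton, Measure.pi_pi, ENNReal.toReal_prod]
  refine Finset.prod_congr rfl fun e _ => ?_
  rw [← measureReal_def, bernoulliMeasure_real_apply _ (measurableSet_singleton _)]
  cases h : η e <;> simp [weight]

lemma measurableSet_of_dependsOn_finset {F : Finset ι} {A : Set (ι → Bool)}
    (hA : DependsOn (· ∈ A) (F : Set ι)) : MeasurableSet A := by
  have hA' : A = F.restrict ⁻¹' {η : F → Bool | ext F η ∈ A} := by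
    ext ω
    refine mem_iff_of_dependsOn hA fun i hi => ?_
    have hi' : i ∈ F := hi
    simp [ext, hi']
  rw [hA']
  exact (by fun_prop : Measurable (F.restrict : (ι → Bool) → F → Bool))
    (Set.Finite.measurableSet (Set.toFinite _))

lemma continuous_bernPoly (F : Finset ι) (A : Set (ι → Bool)) : Continuous (bernPoly F A) := by
  unfold bernPoly
  refine continuous_finsetSum _ fun η _ => ?_
  split_ifs
  · refine continuous_finsetProd _ fun e _ => ?_
    unfold weight
    split_ifs <;> fun_prop
  · exact continuous_const

open scoped Classical in
/-- The event that `A` holds once the coordinate `e` has been set to `b`. -/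
def setCoord (A : Set (ι → Bool)) (e : ι) (b : Bool) : Set (ι → Bool) :=
  {ω | Function.update ω e b ∈ A}

lemma ext_update [DecidableEq ι] (F : Finset ι) (η : F → Bool) (e : F) (b : Bool) :
    ext F (Function.update η e b) = Function.update (ext F η) e b := by
  ext i
  by_cases hi : i = e
  · subst hi; simp [ext]
  · by_cases hF : i ∈ F
    · have : (⟨i, hF⟩ : F) ≠ e := fun h => hi (congrArg Subtype.val h)
      simp [ext, hF, hi, this]
    · simp [ext, hF, hi]

/-- Russo's formula. -/
lemma hasDerivAt_bernPoly (F : Finset ι) (A : Set (ι → Bool)) {x : ι → ℝ → ℝ} {x' : ι → ℝ} {t : ℝ}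
    (hx : ∀ e, HasDerivAt (x e) (x' e) t) :
    HasDerivAt (fun t => bernPoly F A fun e => x e t)
      (∑ e : F, x' e * ((bernPoly F (setCoord A e true) fun e => x e t) -
        bernPoly F (setCoord A e false) fun e => x e t)) t := by
  classical
  let s : Bool → ℝ := fun b => if b then 1 else -1
  let R : (F → Bool) → F → ℝ := fun η e => ∏ j ∈ Finset.univ.erase e, weight (x j t) (η j)
  have hw (e : ι) (b : Bool) : HasDerivAt (fun t => weight (x e t) b) (s b * x' e) t := by
    cases b
    · simpa [weight, s] using (hx e).const_sub 1
    · simpa [weight, s] using hx e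
  have h1 : HasDerivAt (fun t => bernPoly F A fun e => x e t)
      (∑ η : F → Bool, if ext F η ∈ A then ∑ e : F, R η e * (s (η e) * x' e) else 0) t := by
    unfold bernPoly
    refine HasDerivAt.fun_sum fun η _ => ?_
    split_ifs
    · exact HasDerivAt.fun_finsetProd fun e _ => hw e (η e)
    · exact hasDerivAt_const _ _
  convert h1 using 1
  let c : (F → Bool) → ℝ := fun η => if ext F η ∈ A then 1 else 0
  have h2 : (∑ η : F → Bool, if ext F η ∈ A then ∑ e : F, R η e * (s (η e) * x' e) else 0) =
      ∑ e : F, x' e * ∑ η : F → Bool, c η * (R η e * s (η e)) := by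
    simp_rw [Finset.mul_sum]
    rw [Finset.sum_comm]
    refine Finset.sum_congr rfl fun η _ => ?_
    by_cases h : ext F η ∈ A
    · simp only [h, if_true, c]
      exact Finset.sum_congr rfl fun e _ => by ring
    · simp [h, c]
  rw [h2]
  refine Finset.sum_congr rfl fun e _ => ?_
  congr 1
  have h3 (b : Bool) : (bernPoly F (setCoord A e b) fun e => x e t) =
      ∑ η : F → Bool, c (Function.update η e b) * (R η e * weight (x e t) (η e)) := by
    unfold bernPoly
    refine Finset.sum_congr rfl fun η _ => ?_
    have : ext F η ∈ setCoord A e b ↔ ext F (Function.update η e b) ∈ A := by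
      rw [ext_update]
      simp only [setCoord, Set.mem_ofPred_eq]
    simp only [this, c, R]
    rw [Finset.prod_erase_mul _ _ (Finset.mem_univ e)]
    split_ifs <;> simp
  rw [h3, h3, ← Finset.sum_sub_distrib]
  -- Flipping the coordinate `e` leaves `R η e` unchanged. Averaging each summand with its flip, the
  -- two weights add up to `1` on one side, and the signs produce the same difference of indicators
  -- on the other.
  let φ : (F → Bool) ≃ (F → Bool) :=
    Function.Involutive.toPerm (fun η => Function.update η e (!η e)) fun η => by simp
  have hR (η : F → Bool) : R (φ η) e = R η e := by
    refine Finset.prod_congr rfl fun j hj => ?_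
    have : j ≠ e := (Finset.mem_erase.1 hj).1
    simp [φ, Function.Involutive.toPerm, this]
  have hsym (g : (F → Bool) → ℝ) : ∑ η, g η = 2⁻¹ * ∑ η, (g η + g (φ η)) := by
    rw [Finset.sum_add_distrib, Equiv.sum_comp φ g]
    ring
  rw [hsym, hsym (fun η => c η * _)]
  congr 1
  refine Finset.sum_congr rfl fun η _ => ?_
  rw [hR]
  have hφ : φ η = Function.update η e (!η e) := rfl
  have hη : Function.update η e (η e) = η := Function.update_eq_self _ _
  rw [hφ]
  simp only [Function.update_idem, Function.update_self]
  cases h : η e <;> rw [h] at hη <;> simp [hη, weight, s] <;> ring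

end Bernoulli

/-! ### Open paths inside a set: locality and measurability. -/

section Connectivity

variable {d : ℕ}

lemma openGraph_adj {ω : Config d} {y z : Fin d → ℤ} :
    (openGraph ω).Adj y z ↔ ∃ h : (lattice d).Adj y z, ω ⟨s(y, z), h⟩ = true := by
  simp only [openGraph, SimpleGraph.fromEdgeSet_adj]
  constructor
  · rintro ⟨⟨h, h'⟩, -⟩
    exact ⟨h, h'⟩
  · rintro ⟨h, h'⟩
    exact ⟨⟨h, h'⟩, h.ne⟩

/-- The open edges with both endpoints in `S`. -/
def within (ω : Config d) (S : Set (Fin d → ℤ)) : SimpleGraph (Fin d → ℤ) where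
  Adj y z := (openGraph ω).Adj y z ∧ y ∈ S ∧ z ∈ S
  symm := ⟨fun _ _ h => ⟨h.1.symm, h.2.2, h.2.1⟩⟩
  loopless := ⟨fun _ h => h.1.ne rfl⟩

lemma within_le (ω : Config d) (S : Set (Fin d → ℤ)) : within ω S ≤ openGraph ω :=
  fun _ _ h => h.1

lemma within_mono (ω : Config d) {S T : Set (Fin d → ℤ)} (h : S ⊆ T) : within ω S ≤ within ω T :=
  fun _ _ h' => ⟨h'.1, h h'.2.1, h h'.2.2⟩

lemma within_univ (ω : Config d) : within ω Set.univ = openGraph ω := by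
  ext; simp [within]

lemma mem_of_reachable_within {ω : Config d} {S : Set (Fin d → ℤ)} {x y : Fin d → ℤ}
    (hx : x ∈ S) (h : (within ω S).Reachable x y) : y ∈ S := by
  rw [SimpleGraph.reachable_iff_reflTransGen] at h
  induction h with
  | refl => exact hx
  | tail _ h _ => exact h.2.2

/-- The lattice edges with both endpoints in `S`. -/
def edgesIn (S : Set (Fin d → ℤ)) : Set (lattice d).edgeSet :=
  {e | ∀ v ∈ (e : Sym2 (Fin d → ℤ)), v ∈ S}

lemma mk_mem_edgesIn {S : Set (Fin d → ℤ)} {y z : Fin d → ℤ} (h : (lattice d).Adj y z) :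
    (⟨s(y, z), h⟩ : (lattice d).edgeSet) ∈ edgesIn S ↔ y ∈ S ∧ z ∈ S := by
  simp [edgesIn]

lemma openGraph_adj_congr {ω ω' : Config d} {T : Set (lattice d).edgeSet}
    (h : ∀ e ∈ T, ω e = ω' e) {y z : Fin d → ℤ}
    (hT : ∀ h : (lattice d).Adj y z, (⟨s(y, z), h⟩ : (lattice d).edgeSet) ∈ T) :
    (openGraph ω).Adj y z ↔ (openGraph ω').Adj y z := by
  simp only [openGraph_adj]
  exact exists_congr fun hyz => by rw [h _ (hT hyz)]

lemma within_congr {ω ω' : Config d} {S : Set (Fin d → ℤ)}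
    (h : ∀ e ∈ edgesIn S, ω e = ω' e) : within ω S = within ω' S := by
  ext y z
  refine and_congr_left fun hyz => ?_
  exact openGraph_adj_congr h fun h => (mk_mem_edgesIn h).2 hyz

lemma dependsOn_within (P : SimpleGraph (Fin d → ℤ) → Prop) (S : Set (Fin d → ℤ)) :
    DependsOn (· ∈ {ω : Config d | P (within ω S)}) (edgesIn S) :=
  dependsOn_of_imp fun ω ω' h hω => by
    change P (within ω' S)
    rw [← within_congr h]
    exact hω

lemma dependsOn_adj (y z : Fin d → ℤ) :
    DependsOn (· ∈ {ω : Config d | (openGraph ω).Adj y z})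
      {e : (lattice d).edgeSet | (e : Sym2 (Fin d → ℤ)) = s(y, z)} :=
  dependsOn_of_imp fun _ _ h hω => (openGraph_adj_congr h fun _ => rfl).1 hω

lemma measurableSet_adj (y z : Fin d → ℤ) :
    MeasurableSet {ω : Config d | (openGraph ω).Adj y z} := by
  simp only [openGraph_adj]
  by_cases h : (lattice d).Adj y z
  · simp only [h, exists_true_left]
    exact (measurable_pi_apply (X := fun _ => Bool) (⟨s(y, z), h⟩ : (lattice d).edgeSet))
      (measurableSet_singleton true)
  · simp [h]

lemma measurableSet_within_adj (S : Set (Fin d → ℤ)) (y z : Fin d → ℤ) :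
    MeasurableSet {ω : Config d | (within ω S).Adj y z} := by
  by_cases h : y ∈ S ∧ z ∈ S
  · have : {ω : Config d | (within ω S).Adj y z} = {ω : Config d | (openGraph ω).Adj y z} := by
      ext ω
      exact and_iff_left h
    rw [this]
    exact measurableSet_adj y z
  · have : {ω : Config d | (within ω S).Adj y z} = ∅ := by
      ext ω
      exact iff_of_false (fun h' => h h'.2) id
    rw [this]
    exact MeasurableSet.empty

/-- Reachability is a countable union over walk lengths, and a walk of length `n + 1` splits at its
first edge into countably many cases. -/
lemma measurableSet_reachable (S : Set (Fin d → ℤ)) (x y : Fin d → ℤ) :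
    MeasurableSet {ω : Config d | (within ω S).Reachable x y} := by
  have h (n : ℕ) : ∀ x, MeasurableSet
      {ω : Config d | ∃ w : (within ω S).Walk x y, w.length = n} := by
    induction n with
    | zero =>
      intro x
      by_cases hxy : x = y
      · subst hxy
        convert MeasurableSet.univ
        ext ω
        exact iff_of_true ⟨SimpleGraph.Walk.nil, rfl⟩ trivial
      · convert MeasurableSet.empty
        ext ω
        exact iff_of_false (fun ⟨w, hw⟩ => hxy (SimpleGraph.Walk.eq_of_length_eq_zero hw)) id
    | succ n ih =>
      intro x
      have : {ω : Config d | ∃ w : (within ω S).Walk x y, w.length = n + 1} =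
          ⋃ z, ({ω : Config d | (within ω S).Adj x z} ∩
            {ω : Config d | ∃ w : (within ω S).Walk z y, w.length = n}) := by
        ext ω
        simp only [Set.mem_iUnion]
        constructor
        · rintro ⟨w, hw⟩
          cases w with
          | nil => simp at hw
          | cons h w => exact ⟨_, h, w, by simpa using hw⟩
        · rintro ⟨z, h, w, hw⟩
          exact ⟨SimpleGraph.Walk.cons h w, by simpa using hw⟩
      rw [this]
      exact MeasurableSet.iUnion fun z => (measurableSet_within_adj S x z).inter (ih z)
  have : {ω : Config d | (within ω S).Reachable x y} =
      ⋃ n, {ω : Config d | ∃ w : (within ω S).Walk x y, w.length = n} := by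
    ext ω
    simp only [Set.mem_iUnion]
    exact ⟨fun ⟨w⟩ => ⟨_, w, rfl⟩, fun ⟨_, w, _⟩ => ⟨w⟩⟩
  rw [this]
  exact MeasurableSet.iUnion fun n => h n x

/-- The event that `x` lies in an infinite cluster of the open subgraph induced on `S`. -/
def percolatesIn (S : Set (Fin d → ℤ)) (x : Fin d → ℤ) : Set (Config d) :=
  {ω | {v | (within ω S).Reachable x v}.Infinite}

lemma dependsOn_percolatesIn (S : Set (Fin d → ℤ)) (x : Fin d → ℤ) :
    DependsOn (· ∈ percolatesIn S x) (edgesIn S) :=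
  dependsOn_within (fun G => {v | G.Reachable x v}.Infinite) S

lemma percolatesIn_univ (x : Fin d → ℤ) : percolatesIn Set.univ x = percolates x := by
  simp only [percolatesIn, percolates, within_univ, cluster]

lemma percolatesIn_mono {S T : Set (Fin d → ℤ)} (h : S ⊆ T) (x : Fin d → ℤ) :
    percolatesIn S x ⊆ percolatesIn T x := fun _ hω =>
  Set.Infinite.mono (fun _ hv => SimpleGraph.Reachable.mono (within_mono _ h) hv) hω

lemma percolatesIn_subset (S : Set (Fin d → ℤ)) (x : Fin d → ℤ) :
    percolatesIn S x ⊆ percolates x := by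
  rw [← percolatesIn_univ]
  exact percolatesIn_mono (Set.subset_univ S) x

lemma measurableSet_percolatesIn (S : Set (Fin d → ℤ)) (x : Fin d → ℤ) :
    MeasurableSet (percolatesIn S x) := by
  have : percolatesIn S x = ⋂ N : Finset (Fin d → ℤ), ⋃ v, ⋃ _ : v ∉ N,
      {ω : Config d | (within ω S).Reachable x v} := by
    ext ω
    simp only [Set.mem_iInter, Set.mem_iUnion]
    constructor
    · intro h N
      obtain ⟨v, hv, hN⟩ := Set.Infinite.exists_notMem_finset h N
      exact ⟨v, hN, hv⟩
    · intro h hfin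
      obtain ⟨v, hv, hr⟩ := h (Set.Finite.toFinset hfin)
      exact hv ((Set.Finite.mem_toFinset hfin).2 hr)
  rw [this]
  exact MeasurableSet.iInter fun N => MeasurableSet.iUnion fun v =>
    MeasurableSet.iUnion fun _ => measurableSet_reachable S x v

/-- Decomposition of a path at its last exit from a set `D`. -/
lemma exists_last_exit {ω : Config d} {D : Set (Fin d → ℤ)} {x v : Fin d → ℤ} (hx : x ∈ D)
    (h : (openGraph ω).Reachable x v) (hv : v ∉ D) :
    ∃ y ∈ D, ∃ z ∉ D, (openGraph ω).Adj y z ∧ (within ω Dᶜ).Reachable z v := by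
  rw [SimpleGraph.reachable_iff_reflTransGen] at h
  induction h with
  | refl => exact absurd hx hv
  | @tail u w _ huw ih =>
    by_cases hu : u ∈ D
    · exact ⟨u, hu, w, hv, huw, SimpleGraph.Reachable.rfl⟩
    · obtain ⟨y, hy, z, hz, hyz, hzu⟩ := ih hu
      exact ⟨y, hy, z, hz, hyz, hzu.trans (SimpleGraph.Adj.reachable ⟨huw, hu, hv⟩)⟩

/-- The neighbours of the origin in the lattice. -/
noncomputable def unitVectors (d : ℕ) : Finset (Fin d → ℤ) :=
  (Finset.Icc (-1) 1).filter fun v => ∑ i, |v i| = 1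

lemma mem_unitVectors {v : Fin d → ℤ} : v ∈ unitVectors d ↔ ∑ i, |v i| = 1 := by
  simp only [unitVectors, Finset.mem_filter, Finset.mem_Icc, and_iff_right_iff_imp]
  intro h
  have (i : Fin d) : |v i| ≤ 1 := by
    rw [← h]
    exact Finset.single_le_sum (f := fun i => |v i|) (fun i _ => abs_nonneg _) (Finset.mem_univ i)
  exact ⟨fun i => (abs_le.1 (this i)).1, fun i => (abs_le.1 (this i)).2⟩

lemma lattice_adj_add {y v : Fin d → ℤ} : (lattice d).Adj y (y + v) ↔ v ∈ unitVectors d := by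
  simp [mem_unitVectors, lattice]

lemma exists_unitVector {y z : Fin d → ℤ} (h : (lattice d).Adj y z) :
    ∃ v ∈ unitVectors d, z = y + v := by
  refine ⟨z - y, ?_, by simp⟩
  rw [← lattice_adj_add (y := y)]
  simpa using h

lemma lattice_adj_of_openGraph {ω : Config d} {y z : Fin d → ℤ} (h : (openGraph ω).Adj y z) :
    (lattice d).Adj y z :=
  (openGraph_adj.1 h).1

end Connectivity

/-! ### Edge probabilities, boundary flux and independence. -/

section Probability

variable {d : ℕ}

open scoped Classical in
/-- The probability that the edge `{y, z}` is open. -/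
noncomputable def openProb (s : ℕ) (p q : ℝ) (y z : Fin d → ℤ) : ℝ :=
  if y ∈ sublattice d s ∧ z ∈ sublattice d s then q else p

lemma edgeProb_mk {s : ℕ} (p q : I) {y z : Fin d → ℤ} (h : (lattice d).Adj y z) :
    (edgeProb d s p q ⟨s(y, z), h⟩ : ℝ) = openProb s p q y z := by
  have : (∀ v ∈ s(y, z), v ∈ sublattice d s) ↔ y ∈ sublattice d s ∧ z ∈ sublattice d s := by simp
  simp only [edgeProb, openProb, this]
  split_ifs <;> first | rfl | tauto

instance (s : ℕ) (p q : I) : IsProbabilityMeasure (percMeasure d s p q) := by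
  unfold percMeasure
  infer_instance

lemma percMeasure_adj {s : ℕ} (p q : I) {y z : Fin d → ℤ} (h : (lattice d).Adj y z) :
    (percMeasure d s p q).real {ω | (openGraph ω).Adj y z} = openProb s p q y z := by
  have : {ω : Config d | (openGraph ω).Adj y z} =
      (fun ω => ω ⟨s(y, z), h⟩) ⁻¹' {true} := by
    ext ω
    exact openGraph_adj.trans ⟨fun ⟨_, h⟩ => h, fun h' => ⟨h, h'⟩⟩
  rw [this, ← map_measureReal_apply (measurable_pi_apply _) (measurableSet_singleton _),
    percMeasure, Measure.infinitePi_map_eval,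
    bernoulliMeasure_real_apply _ (measurableSet_singleton _), ← edgeProb_mk p q h]
  simp

/-- The expected number of open edges leaving the cluster of `x` in `S` through the boundary
of `S`. -/
noncomputable def boundaryFlux (s : ℕ) (p q : I) (x : Fin d → ℤ) (S : Finset (Fin d → ℤ)) : ℝ :=
  ∑ y ∈ S, ∑ v ∈ unitVectors d, if y + v ∈ S then 0 else openProb s p q y (y + v) *
    (percMeasure d s p q).real {ω | (within ω S).Reachable x y}

lemma percMeasure_inter {s : ℕ} (p q : I) {A B : Set (Config d)}
    {S T : Set (lattice d).edgeSet} (hST : Disjoint S T) (hA : DependsOn (· ∈ A) S)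
    (hB : DependsOn (· ∈ B) T) (mA : MeasurableSet A) (mB : MeasurableSet B) :
    (percMeasure d s p q).real (A ∩ B) =
      (percMeasure d s p q).real A * (percMeasure d s p q).real B := by
  simp only [measureReal_def]
  rw [← ENNReal.toReal_mul]
  exact congrArg _ (bern_inter_of_disjoint _ hST hA hB mA mB)

end Probability

/-! ### Small boundary flux excludes percolation. -/

section Subcritical

variable {d : ℕ}

/-- The event that the cluster of `x` in `S` is exactly `D`. -/
def clusterEq (S : Set (Fin d → ℤ)) (x : Fin d → ℤ) (D : Set (Fin d → ℤ)) : Set (Config d) :=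
  {ω | {u | (within ω S).Reachable x u} = D}

lemma measurableSet_clusterEq (S : Set (Fin d → ℤ)) (x : Fin d → ℤ) (D : Set (Fin d → ℤ)) :
    MeasurableSet (clusterEq S x D) := by
  have : clusterEq S x D = ⋂ u, {ω : Config d | (within ω S).Reachable x u ↔ u ∈ D} := by
    ext ω
    simp only [Set.mem_iInter]
    exact Set.ext_iff
  rw [this]
  exact MeasurableSet.iInter fun u => (measurableSet_reachable S x u).iff (MeasurableSet.const _)

lemma edge_mem_compl_edgesIn {D : Set (Fin d → ℤ)} {y z : Fin d → ℤ} (h : (lattice d).Adj y z)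
    (hy : y ∈ D) : (⟨s(y, z), h⟩ : (lattice d).edgeSet) ∈ (edgesIn Dᶜ)ᶜ := fun h' =>
  ((mk_mem_edgesIn h).1 h').1 hy

/-- The cluster of `x` is determined by the edges that touch it. -/
lemma dependsOn_clusterEq {S D : Set (Fin d → ℤ)} {x : Fin d → ℤ} :
    DependsOn (· ∈ clusterEq S x D) (edgesIn Dᶜ)ᶜ := by
  refine dependsOn_of_imp fun ω ω' h hω => ?_
  have hω : {u | (within ω S).Reachable x u} = D := hω
  have hx : x ∈ D := by rw [← hω]; exact SimpleGraph.Reachable.rfl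
  -- Exploring the cluster from `x` only queries edges with an endpoint in `D`, on which the two
  -- configurations agree.
  have hadj {y z : Fin d → ℤ} (hy : y ∈ D) : (within ω S).Adj y z ↔ (within ω' S).Adj y z :=
    and_congr_left fun _ => openGraph_adj_congr h fun h => edge_mem_compl_edgesIn h hy
  refine Set.Subset.antisymm (fun u hu => ?_) fun u hu => ?_
  · have hu' : (within ω' S).Reachable x u := hu
    clear hu
    rw [SimpleGraph.reachable_iff_reflTransGen] at hu'
    induction hu' with
    | refl => exact hx
    | @tail v w _ hvw ih =>
      have := (hadj ih).2 hvw
      rw [← hω] at ih ⊢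
      exact SimpleGraph.Reachable.trans ih this.reachable
  · have hu' : (within ω S).Reachable x u := by rw [← hω] at hu; exact hu
    change (within ω' S).Reachable x u
    clear hu
    rw [SimpleGraph.reachable_iff_reflTransGen] at hu'
    induction hu' with
    | refl => exact SimpleGraph.Reachable.rfl
    | @tail v w h' hvw ih =>
      have hv : v ∈ D := by
        rw [← hω]
        exact (SimpleGraph.reachable_iff_reflTransGen _ _).2 h'
      exact ih.trans ((hadj hv).1 hvw).reachable

/-- An infinite cluster leaves every finite set `S`: it crosses the boundary of `S` and continues
off the cluster in `S`. -/
lemma exists_percolatesIn_compl {ω : Config d} {x : Fin d → ℤ} {S : Finset (Fin d → ℤ)}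
    (hx : x ∈ S) (hω : ω ∈ percolates x) {D : Set (Fin d → ℤ)} (hD : ω ∈ clusterEq S x D) :
    ∃ y ∈ D, ∃ v ∈ unitVectors d, y + v ∉ S ∧ (openGraph ω).Adj y (y + v) ∧
      ω ∈ percolatesIn Dᶜ (y + v) := by
  have hD : {u | (within ω S).Reachable x u} = D := hD
  have hxD : x ∈ D := by rw [← hD]; exact SimpleGraph.Reachable.rfl
  have hDS : D ⊆ S := by
    rw [← hD]
    exact fun u hu => mem_of_reachable_within (S := (S : Set (Fin d → ℤ))) hx hu
  have hDfin : D.Finite := S.finite_toSet.subset hDS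
  by_contra! hcon
  have hfin : (⋃ y ∈ D, ⋃ v ∈ unitVectors d, ⋃ _ : (openGraph ω).Adj y (y + v) ∧ y + v ∉ S,
      {u | (within ω Dᶜ).Reachable (y + v) u}).Finite := by
    refine hDfin.biUnion fun y hy => (unitVectors d).finite_toSet.biUnion fun v hv =>
      Set.finite_iUnion fun h => ?_
    exact Set.not_infinite.1 (hcon y hy v hv h.2 h.1)
  refine hω ((hDfin.union hfin).subset fun u hu => ?_)
  by_cases huD : u ∈ D
  · exact Or.inl huD
  · obtain ⟨y, hy, z, hz, hyz, hzu⟩ := exists_last_exit hxD hu huD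
    obtain ⟨v, hv, rfl⟩ := exists_unitVector (lattice_adj_of_openGraph hyz)
    -- A last exit from `D` to a vertex of `S` would put that vertex in the cluster `D` itself.
    have hzS : y + v ∉ S := fun hzS => hz <| by
      have hy' := hy
      rw [← hD] at hy' ⊢
      exact SimpleGraph.Reachable.trans hy' (SimpleGraph.Adj.reachable ⟨hyz, hDS hy, hzS⟩)
    refine Or.inr ?_
    simp only [Set.mem_iUnion]
    exact ⟨y, hy, v, hv, ⟨hyz, hzS⟩, hzu⟩

variable {s : ℕ} {p q : I}

lemma percMeasure_reachable_inter_adj {x y z : Fin d → ℤ} {S : Finset (Fin d → ℤ)} (hz : z ∉ S)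
    (h : (lattice d).Adj y z) :
    (percMeasure d s p q).real ({ω | (within ω S).Reachable x y} ∩ {ω | (openGraph ω).Adj y z}) =
      openProb s p q y z * (percMeasure d s p q).real {ω | (within ω S).Reachable x y} := by
  rw [percMeasure_inter (S := edgesIn (S : Set (Fin d → ℤ)))
    (T := {e : (lattice d).edgeSet | (e : Sym2 (Fin d → ℤ)) = s(y, z)}) p q ?_
    (dependsOn_within (fun G => G.Reachable x y) _)
    (dependsOn_adj y z) (measurableSet_reachable _ x y) (measurableSet_adj y z),
    percMeasure_adj p q h, mul_comm]
  rw [Set.disjoint_left]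
  intro e he he'
  have he' : (e : Sym2 (Fin d → ℤ)) = s(y, z) := he'
  exact hz (he z (by rw [he']; simp))

/-- Decompose according to the cluster `D` of `x` in `S` and the edge by which an infinite path last
leaves `D`. The cluster and this edge depend on edges touching `D`, the continuation on edges
avoiding `D`, so independence gives a factor at most `θ`. Summing over `D` recovers the flux. -/
lemma percMeasure_percolates_le {x : Fin d → ℤ} {S : Finset (Fin d → ℤ)} (hx : x ∈ S) {θ : ℝ}
    (hθ : ∀ z, (percMeasure d s p q).real (percolates z) ≤ θ) :
    (percMeasure d s p q).real (percolates x) ≤ boundaryFlux s p q x S * θ := by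
  classical
  set μ := percMeasure d s p q with hμ
  have : IsProbabilityMeasure μ := inferInstanceAs (IsProbabilityMeasure (percMeasure d s p q))
  let E (y v : Fin d → ℤ) (D : Finset (Fin d → ℤ)) : Set (Config d) :=
    clusterEq S x D ∩ {ω | (openGraph ω).Adj y (y + v)}
  let P (y : Fin d → ℤ) : Finset (Finset (Fin d → ℤ)) := S.powerset.filter fun D => y ∈ D
  have hsub : percolates x ⊆ ⋃ y ∈ S, ⋃ v ∈ (unitVectors d).filter fun v => y + v ∉ S,
      ⋃ D ∈ P y, (E y v D ∩ percolatesIn (D : Set (Fin d → ℤ))ᶜ (y + v)) := by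
    intro ω hω
    have hfin : {u | (within ω S).Reachable x u}.Finite := S.finite_toSet.subset fun u hu =>
      mem_of_reachable_within (S := (S : Set (Fin d → ℤ))) hx hu
    have hDS : hfin.toFinset ⊆ S := fun u hu =>
      mem_of_reachable_within (S := (S : Set (Fin d → ℤ))) hx (hfin.mem_toFinset.1 hu)
    have hD : ω ∈ clusterEq S x (hfin.toFinset : Set (Fin d → ℤ)) := by
      change _ = _
      simp
    obtain ⟨y, hy, v, hv, hvS, hadj, hperc⟩ := exists_percolatesIn_compl hx hω hD
    simp only [Set.mem_iUnion]
    exact ⟨y, hDS hy, v, Finset.mem_filter.2 ⟨hv, hvS⟩, hfin.toFinset,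
      Finset.mem_filter.2 ⟨Finset.mem_powerset.2 hDS, hy⟩, ⟨hD, hadj⟩, hperc⟩
  have mE (y v D) : MeasurableSet (E y v D) :=
    (measurableSet_clusterEq _ _ _).inter (measurableSet_adj _ _)
  have hE (y v D) (hD : D ∈ P y) : μ.real (E y v D ∩ percolatesIn (D : Set (Fin d → ℤ))ᶜ (y + v)) ≤
      μ.real (E y v D) * θ := by
    have hyD : y ∈ D := (Finset.mem_filter.1 hD).2
    rw [percMeasure_inter p q (disjoint_compl_left (a := edgesIn (D : Set (Fin d → ℤ))ᶜ)) ?_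
      (dependsOn_percolatesIn _ _) (mE y v D)
      (measurableSet_percolatesIn _ _)]
    · refine mul_le_mul_of_nonneg_left ?_ measureReal_nonneg
      exact (measureReal_mono (percolatesIn_subset _ _)).trans (hθ _)
    · refine dependsOn_inter dependsOn_clusterEq ((dependsOn_adj y (y + v)).mono fun e he he' => ?_)
      have he : (e : Sym2 (Fin d → ℤ)) = s(y, y + v) := he
      exact he' y (by rw [he]; simp) hyD
  have hθ0 : 0 ≤ θ := measureReal_nonneg.trans (hθ 0)
  have hsum (y v) (hv : v ∈ (unitVectors d).filter fun v => y + v ∉ S) :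
      ∑ D ∈ P y, μ.real (E y v D) ≤
      openProb s p q y (y + v) * μ.real {ω | (within ω S).Reachable x y} := by
    rw [Finset.mem_filter] at hv
    rw [← percMeasure_reachable_inter_adj hv.2 (lattice_adj_add.2 hv.1),
      ← measureReal_biUnion_finset _ fun D _ => mE y v D]
    · refine measureReal_mono fun ω hω => ?_
      simp only [Set.mem_iUnion] at hω
      obtain ⟨D, hD, h, h'⟩ := hω
      refine ⟨?_, h'⟩
      have h : {u | (within ω S).Reachable x u} = D := h
      have hy : y ∈ (D : Set (Fin d → ℤ)) := (Finset.mem_filter.1 hD).2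
      rw [← h] at hy
      exact hy
    · intro D _ D' _ hne
      refine Set.disjoint_left.2 fun ω h h' => hne ?_
      have h1 : {u | (within ω S).Reachable x u} = D := h.1
      have h2 : {u | (within ω S).Reachable x u} = D' := h'.1
      exact Finset.coe_injective (h1.symm.trans h2)
  calc μ.real (percolates x) ≤ _ := measureReal_mono hsub (measure_ne_top _ _)
    _ ≤ ∑ y ∈ S, ∑ v ∈ (unitVectors d).filter fun v => y + v ∉ S, ∑ D ∈ P y,
        μ.real (E y v D ∩ percolatesIn (D : Set (Fin d → ℤ))ᶜ (y + v)) := by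
      refine (measureReal_biUnion_finset_le _ _).trans (Finset.sum_le_sum fun y _ => ?_)
      refine (measureReal_biUnion_finset_le _ _).trans (Finset.sum_le_sum fun v _ => ?_)
      exact measureReal_biUnion_finset_le _ _
    _ ≤ ∑ y ∈ S, ∑ v ∈ (unitVectors d).filter fun v => y + v ∉ S,
        openProb s p q y (y + v) * μ.real {ω | (within ω S).Reachable x y} * θ := by
      refine Finset.sum_le_sum fun y _ => Finset.sum_le_sum fun v hv => ?_
      refine (Finset.sum_le_sum fun D hD => hE y v D hD).trans ?_
      rw [← Finset.sum_mul]
      exact mul_le_mul_of_nonneg_right (hsum y v hv) hθ0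
    _ = boundaryFlux s p q x S * θ := by
      rw [boundaryFlux, Finset.sum_mul]
      refine Finset.sum_congr rfl fun y _ => ?_
      rw [← Finset.sum_mul, Finset.sum_filter]
      simp only [ite_not, hμ]

/-- If every vertex has a finite neighbourhood with uniformly small boundary flux, there is no
infinite cluster. -/
lemma percMeasure_percolates_eq_zero {c : ℝ} (hc : c < 1)
    (h : ∀ x : Fin d → ℤ, ∃ S : Finset (Fin d → ℤ), x ∈ S ∧ boundaryFlux s p q x S ≤ c)
    (x : Fin d → ℤ) : percMeasure d s p q (percolates x) = 0 := by
  -- The law is not invariant under all translations, so the supremum over all starting vertices is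
  -- contracted.
  let f : (Fin d → ℤ) → ℝ := fun z => (percMeasure d s p q).real (percolates z)
  have hb : BddAbove (Set.range f) := ⟨1, by rintro _ ⟨z, rfl⟩; exact measureReal_le_one⟩
  have hθ (z) : f z ≤ ⨆ z, f z := le_ciSup hb z
  have h0 : 0 ≤ ⨆ z, f z := measureReal_nonneg.trans (hθ 0)
  have hle : ⨆ z, f z ≤ c * ⨆ z, f z := ciSup_le fun z => by
    obtain ⟨S, hz, hS⟩ := h z
    exact (percMeasure_percolates_le hz hθ).trans (mul_le_mul_of_nonneg_right hS h0)
  have : f x = 0 := le_antisymm ((hθ x).trans (by nlinarith)) measureReal_nonneg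
  exact (measureReal_eq_zero_iff).1 this

end Subcritical

/-! ### Leaving a finite box: locality and pivotal edges. -/

section Exit

variable {d : ℕ}

/-- The event that the cluster of `x` is not contained in `Λ`. -/
def exits (Λ : Finset (Fin d → ℤ)) (x : Fin d → ℤ) : Set (Config d) :=
  {ω | ∃ v ∉ Λ, (openGraph ω).Reachable x v}

lemma exits_of_notMem {Λ : Finset (Fin d → ℤ)} {x : Fin d → ℤ} (hx : x ∉ Λ) (ω : Config d) :
    ω ∈ exits Λ x :=
  ⟨x, hx, SimpleGraph.Reachable.rfl⟩

lemma exits_of_adj {Λ : Finset (Fin d → ℤ)} {x y : Fin d → ℤ} {ω : Config d}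
    (h : (openGraph ω).Reachable x y) (hy : ω ∈ exits Λ y) : ω ∈ exits Λ x :=
  let ⟨v, hv, hyv⟩ := hy
  ⟨v, hv, h.trans hyv⟩

lemma finite_compl_edgesIn (Λ : Finset (Fin d → ℤ)) :
    ((edgesIn (Λ : Set (Fin d → ℤ))ᶜ)ᶜ).Finite := by
  refine Set.Finite.of_finite_image (f := Subtype.val) ?_ Subtype.val_injective.injOn
  refine (Finset.finite_toSet ((Λ ×ˢ unitVectors d).image fun p => s(p.1, p.1 + p.2))).subset ?_
  rintro _ ⟨⟨e, he⟩, h, rfl⟩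
  induction e using Sym2.ind with
  | _ y z =>
    have hyz : (lattice d).Adj y z := he
    have h' : ¬ (y ∉ Λ ∧ z ∉ Λ) := fun h' => h ((mk_mem_edgesIn hyz).2 h')
    simp only [Finset.coe_image, Set.mem_image, Finset.mem_coe, Finset.mem_product, Prod.exists]
    by_cases hy : y ∈ Λ
    · obtain ⟨v, hv, rfl⟩ := exists_unitVector hyz
      exact ⟨y, v, ⟨hy, hv⟩, rfl⟩
    · have hz : z ∈ Λ := by tauto
      obtain ⟨v, hv, rfl⟩ := exists_unitVector hyz.symm
      exact ⟨z, v, ⟨hz, hv⟩, Sym2.eq_swap⟩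

/-- The lattice edges with at least one endpoint in `Λ`. -/
noncomputable def edgesTouching (Λ : Finset (Fin d → ℤ)) : Finset (lattice d).edgeSet :=
  (finite_compl_edgesIn Λ).toFinset

lemma coe_edgesTouching (Λ : Finset (Fin d → ℤ)) :
    (edgesTouching Λ : Set (lattice d).edgeSet) = (edgesIn (Λ : Set (Fin d → ℤ))ᶜ)ᶜ := by
  simp [edgesTouching]

lemma mk_mem_edgesTouching {Λ : Finset (Fin d → ℤ)} {y z : Fin d → ℤ} (h : (lattice d).Adj y z)
    (hy : y ∈ Λ) : (⟨s(y, z), h⟩ : (lattice d).edgeSet) ∈ edgesTouching Λ := by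
  rw [← Finset.mem_coe, coe_edgesTouching]
  exact edge_mem_compl_edgesIn h hy

lemma edgesIn_subset_edgesTouching (Λ : Finset (Fin d → ℤ)) :
    edgesIn (Λ : Set (Fin d → ℤ)) ⊆ edgesTouching Λ := by
  rw [coe_edgesTouching]
  rintro ⟨e, he⟩ h h'
  induction e using Sym2.ind with
  | _ y z => exact h' y (Sym2.mem_mk_left y z) (h y (Sym2.mem_mk_left y z))

/-- Up to its first vertex outside `Λ`, a path only uses edges that start in `Λ`. -/
lemma dependsOn_exits (Λ : Finset (Fin d → ℤ)) (x : Fin d → ℤ) :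
    DependsOn (· ∈ exits Λ x) (edgesTouching Λ : Set (lattice d).edgeSet) := by
  refine dependsOn_of_imp fun ω ω' h ⟨v, hv, hxv⟩ => ?_
  suffices H : (openGraph ω').Reachable x v ∨ ω' ∈ exits Λ x from H.elim (fun H => ⟨v, hv, H⟩) id
  clear hv
  rw [SimpleGraph.reachable_iff_reflTransGen] at hxv
  induction hxv with
  | refl => exact Or.inl SimpleGraph.Reachable.rfl
  | @tail u w _ huw ih =>
    rcases ih with ih | ih
    · by_cases hu : u ∈ Λ
      · have := (openGraph_adj_congr h fun hl => mk_mem_edgesTouching hl hu).1 huw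
        exact Or.inl (ih.trans this.reachable)
      · exact Or.inr ⟨u, hu, ih⟩
    · exact Or.inr ih

lemma measurableSet_exits (Λ : Finset (Fin d → ℤ)) (x : Fin d → ℤ) :
    MeasurableSet (exits Λ x) :=
  measurableSet_of_dependsOn_finset (dependsOn_exits Λ x)

lemma percolates_eq_iInter (x : Fin d → ℤ) :
    percolates x = ⋂ n : ℕ, exits (Finset.Icc (fun _ => -(n : ℤ)) fun _ => (n : ℤ)) x := by
  ext ω
  simp only [Set.mem_iInter]
  constructor
  · intro h n
    obtain ⟨v, hv, hn⟩ := Set.Infinite.exists_notMem_finset h _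
    exact ⟨v, hn, hv⟩
  · intro h hfin
    obtain ⟨a, ha⟩ : ∃ a : ℕ, ∀ v ∈ hfin.toFinset, ∀ i, |v i| ≤ a := by
      refine ⟨∑ v ∈ hfin.toFinset, ∑ i, (v i).natAbs, fun v hv i => ?_⟩
      rw [Int.abs_eq_natAbs, Int.ofNat_le]
      exact (Finset.single_le_sum (f := fun i => (v i).natAbs) (fun _ _ => Nat.zero_le _)
        (Finset.mem_univ i)).trans (Finset.single_le_sum
        (f := fun v : Fin d → ℤ => ∑ i, (v i).natAbs) (fun _ _ => Nat.zero_le _) hv)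
    obtain ⟨v, hv, hr⟩ := h a
    refine hv (Finset.mem_Icc.2 ?_)
    have := ha v (hfin.mem_toFinset.2 hr)
    exact ⟨fun i => (abs_le.1 (this i)).1, fun i => (abs_le.1 (this i)).2⟩

/-- The event that `S` is the set of vertices whose cluster is contained in `Λ`. -/
def interiorEq (Λ : Finset (Fin d → ℤ)) (S : Set (Fin d → ℤ)) : Set (Config d) :=
  {ω | ∀ x, x ∈ S ↔ ω ∉ exits Λ x}

lemma measurableSet_interiorEq (Λ : Finset (Fin d → ℤ)) (S : Set (Fin d → ℤ)) :
    MeasurableSet (interiorEq Λ S) := by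
  have : interiorEq Λ S = ⋂ x, {ω : Config d | x ∈ S ↔ ω ∉ exits Λ x} := by
    ext ω
    simp only [Set.mem_iInter]
    rfl
  rw [this]
  exact MeasurableSet.iInter fun x =>
    (MeasurableSet.const _).iff (measurableSet_exits Λ x).compl

/-- The complement of `S` is found by exploring inwards from outside `Λ`, which never examines an
edge with both endpoints in `S`. Connections within `S` are therefore independent of this event. -/
lemma dependsOn_interiorEq (Λ : Finset (Fin d → ℤ)) (S : Set (Fin d → ℤ)) :
    DependsOn (· ∈ interiorEq Λ S) (edgesIn S)ᶜ := by
  refine dependsOn_of_imp fun ω ω' h hω => ?_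
  have hω : ∀ x, x ∈ S ↔ ω ∉ exits Λ x := hω
  have hadj {y z : Fin d → ℤ} (hyz : ¬ (y ∈ S ∧ z ∈ S)) :
      (openGraph ω).Adj y z ↔ (openGraph ω').Adj y z :=
    openGraph_adj_congr h fun hl h' => hyz ((mk_mem_edgesIn hl).1 h')
  have hout (x : Fin d → ℤ) (hx : ω ∈ exits Λ x) : ω' ∈ exits Λ x := by
    obtain ⟨v, hv, hxv⟩ := hx
    refine ⟨v, hv, ?_⟩
    rw [SimpleGraph.reachable_iff_reflTransGen] at hxv
    -- Induction from the far end keeps a path out of `Λ` available at each vertex, so no vertex on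
    -- the path is in `S`.
    induction hxv using Relation.ReflTransGen.head_induction_on with
    | refl => exact SimpleGraph.Reachable.rfl
    | @head u w huw hwv ih =>
      refine SimpleGraph.Reachable.trans (SimpleGraph.Adj.reachable ((hadj fun h' => ?_).1 huw)) ih
      exact (hω w).1 h'.2 ⟨v, hv, (SimpleGraph.reachable_iff_reflTransGen _ _).2 hwv⟩
  refine fun x => ⟨fun hx hx' => ?_, fun hx => ?_⟩
  · obtain ⟨v, hv, hxv⟩ := hx'
    have hvS : v ∉ S := fun hvS => (hω v).1 hvS (exits_of_notMem hv ω)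
    obtain ⟨y, hy, z, hz, hyz, -⟩ := exists_last_exit hx hxv hvS
    have hyz' := (hadj fun h' => hz h'.2).2 hyz
    have hzex : ω ∈ exits Λ z := by
      by_contra hcon
      exact hz ((hω z).2 hcon)
    exact (hω y).1 hy (exits_of_adj hyz'.reachable hzex)
  · exact (hω x).2 fun h' => hx (hout x h')

lemma openGraph_mono {ω ω' : Config d} (h : ∀ e, ω e = true → ω' e = true) :
    openGraph ω ≤ openGraph ω' := fun _ _ hyz => by
  obtain ⟨hl, ho⟩ := openGraph_adj.1 hyz
  exact openGraph_adj.2 ⟨hl, h _ ho⟩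

lemma exits_mono {ω ω' : Config d} (h : ∀ e, ω e = true → ω' e = true)
    {Λ : Finset (Fin d → ℤ)} {x : Fin d → ℤ} (hω : ω ∈ exits Λ x) : ω' ∈ exits Λ x :=
  let ⟨v, hv, hxv⟩ := hω
  ⟨v, hv, hxv.mono (openGraph_mono h)⟩

/-- The event that the edge `e` is pivotal for `exits Λ x`. -/
def pivotal (Λ : Finset (Fin d → ℤ)) (x : Fin d → ℤ) (e : (lattice d).edgeSet) : Set (Config d) :=
  setCoord (exits Λ x) e true \ setCoord (exits Λ x) e false

/-- Opening the edge joins `x` to `z`, which already exits since `z ∉ S`; closing it can only shrink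
clusters, and `x ∈ S` does not exit in `ω`. -/
lemma mem_pivotal {Λ : Finset (Fin d → ℤ)} {x y z : Fin d → ℤ} {S : Set (Fin d → ℤ)}
    {ω : Config d} (hω : ω ∈ interiorEq Λ S) (hx : x ∈ S) (hz : z ∉ S)
    (hyz : (lattice d).Adj y z) (hxy : (within ω S).Reachable x y) :
    ω ∈ pivotal Λ x ⟨s(y, z), hyz⟩ := by
  classical
  have hω : ∀ x, x ∈ S ↔ ω ∉ exits Λ x := hω
  constructor
  · have hle (e) : ω e = true → Function.update ω ⟨s(y, z), hyz⟩ true e = true := fun h => by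
      by_cases he : e = ⟨s(y, z), hyz⟩
      · subst he; simp
      · simpa [he] using h
    have hzex : ω ∈ exits Λ z := by
      by_contra hcon
      exact hz ((hω z).2 hcon)
    have : Function.update ω ⟨s(y, z), hyz⟩ true ∈ exits Λ x := by
      refine exits_of_adj ((hxy.mono ((within_le ω S).trans (openGraph_mono hle))).trans ?_)
        (exits_mono hle hzex)
      exact SimpleGraph.Adj.reachable (openGraph_adj.2 ⟨hyz, by simp⟩)
    simp only [setCoord, Set.mem_ofPred_eq]
    convert this
  · intro h
    refine (hω x).1 hx (exits_mono (fun e he => ?_) h)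
    by_cases he' : e = ⟨s(y, z), hyz⟩
    · subst he'; simp at he
    · simpa [he'] using he

lemma dependsOn_setCoord {ι : Type*} {A : Set (ι → Bool)} {T : Set ι} (hA : DependsOn (· ∈ A) T)
    (e : ι) (b : Bool) : DependsOn (· ∈ setCoord A e b) T := by
  classical
  refine dependsOn_of_imp fun ω ω' h hω => ?_
  refine (mem_iff_of_dependsOn hA fun i hi => ?_).1 hω
  by_cases he : i = e
  · subst he; simp
  · simp [he, h i hi]

lemma setCoord_exits_subset (Λ : Finset (Fin d → ℤ)) (x : Fin d → ℤ) (e : (lattice d).edgeSet) :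
    setCoord (exits Λ x) e false ⊆ setCoord (exits Λ x) e true := fun ω hω => by
  refine exits_mono (fun e' he' => ?_) hω
  by_cases h : e' = e
  · subst h; simp
  · simpa [h] using he'

lemma percMeasure_pivotal {s : ℕ} (p q : I) (Λ : Finset (Fin d → ℤ)) (x : Fin d → ℤ)
    (e : (lattice d).edgeSet) : (percMeasure d s p q).real (pivotal Λ x e) =
      (percMeasure d s p q).real (setCoord (exits Λ x) e true) -
      (percMeasure d s p q).real (setCoord (exits Λ x) e false) :=
  measureReal_sdiff (setCoord_exits_subset Λ x e)
    (measurableSet_of_dependsOn_finset (dependsOn_setCoord (dependsOn_exits Λ x) e false))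

end Exit

/-! ### Large boundary flux forces percolation. -/

section Supercritical

variable {d : ℕ}

open scoped Classical in
/-- The vector of opening probabilities, for arbitrary real parameters. -/
noncomputable def paramVec (s : ℕ) (p q : ℝ) (e : (lattice d).edgeSet) : ℝ :=
  if e ∈ edgesIn (sublattice d s) then q else p

lemma coe_edgeProb (s : ℕ) (p q : I) (e : (lattice d).edgeSet) :
    (edgeProb d s p q e : ℝ) = paramVec s p q e := by
  have : (∀ v ∈ (e : Sym2 (Fin d → ℤ)), v ∈ sublattice d s) ↔ e ∈ edgesIn (sublattice d s) :=
    Iff.rfl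
  simp only [edgeProb, paramVec, this]
  split_ifs <;> first | rfl | tauto

lemma percMeasure_eq_bernPoly {s : ℕ} (p q : I) {F : Finset (lattice d).edgeSet}
    {A : Set (Config d)} (hA : DependsOn (· ∈ A) (F : Set (lattice d).edgeSet)) :
    (percMeasure d s p q).real A = bernPoly F A (paramVec s p q) :=
  (bern_real_eq_bernPoly _ hA).trans (congrArg _ (funext fun e => coe_edgeProb s p q e))

open scoped Classical in
/-- The number of pivotal edges in the sublattice is, on average, at least the average over the
set `S` of vertices not connected to the outside of `Λ` of its boundary flux. -/
lemma one_sub_le_sum_pivotal {s : ℕ} (q : I) (Λ : Finset (Fin d → ℤ))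
    (hq : ∀ S : Finset (Fin d → ℤ), 0 ∈ S → 1 ≤ boundaryFlux s 0 q 0 S) :
    1 - (percMeasure d s 0 q).real (exits Λ 0) ≤
      ∑ e ∈ (edgesTouching Λ).filter (· ∈ edgesIn (sublattice d s)),
        (percMeasure d s 0 q).real (pivotal Λ 0 e) := by
  set μ := percMeasure d s 0 q with hμ
  have : IsProbabilityMeasure μ := inferInstanceAs (IsProbabilityMeasure (percMeasure d s 0 q))
  let P : Finset (Finset (Fin d → ℤ)) := Λ.powerset.filter fun S => 0 ∈ S
  let E := (edgesTouching Λ).filter (· ∈ edgesIn (sublattice d s))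
  have mpiv (e) : MeasurableSet (pivotal Λ 0 e) :=
    (measurableSet_of_dependsOn_finset (dependsOn_setCoord (dependsOn_exits Λ 0) e true)).diff
      (measurableSet_of_dependsOn_finset (dependsOn_setCoord (dependsOn_exits Λ 0) e false))
  have hdisj : ∀ S ∈ P, ∀ S' ∈ P, S ≠ S' →
      Disjoint (interiorEq Λ (S : Set (Fin d → ℤ))) (interiorEq Λ (S' : Set (Fin d → ℤ))) := by
    refine fun S _ S' _ hne => Set.disjoint_left.2 fun ω h h' => hne ?_
    ext x
    exact (h x).trans (h' x).symm
  have h1 (e : (lattice d).edgeSet) :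
      ∑ S ∈ P, μ.real (interiorEq Λ S ∩ pivotal Λ 0 e) ≤ μ.real (pivotal Λ 0 e) := by
    rw [← measureReal_biUnion_finset (fun S hS S' hS' hne =>
      (hdisj S hS S' hS' hne).mono Set.inter_subset_left Set.inter_subset_left)
      fun S _ => (measurableSet_interiorEq Λ S).inter (mpiv e)]
    refine measureReal_mono (fun ω hω => ?_) (measure_ne_top _ _)
    simp only [Set.mem_iUnion] at hω
    obtain ⟨S, _, h⟩ := hω
    exact h.2
  have h2 (S : Finset (Fin d → ℤ)) (hS : S ∈ P) :
      μ.real (interiorEq Λ S) ≤ ∑ e ∈ E, μ.real (interiorEq Λ S ∩ pivotal Λ 0 e) := by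
    obtain ⟨hSΛ, h0⟩ := Finset.mem_filter.1 hS
    rw [Finset.mem_powerset] at hSΛ
    -- At `p = 0` only boundary edges lying in `H` contribute to the flux. Orienting them out of `S`
    -- makes the map to edges injective.
    let Q : Finset ((Fin d → ℤ) × (Fin d → ℤ)) := (S ×ˢ unitVectors d).filter fun a =>
      a.1 + a.2 ∉ S ∧ a.1 ∈ sublattice d s ∧ a.1 + a.2 ∈ sublattice d s
    have hQ (a : Q) : a.1.1 ∈ S ∧ a.1.2 ∈ unitVectors d ∧ a.1.1 + a.1.2 ∉ S ∧
        a.1.1 ∈ sublattice d s ∧ a.1.1 + a.1.2 ∈ sublattice d s := by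
      have := a.2
      simp only [Q, Finset.mem_filter, Finset.mem_product] at this
      tauto
    let g : Q → (lattice d).edgeSet := fun a =>
      ⟨s(a.1.1, a.1.1 + a.1.2), lattice_adj_add.2 (hQ a).2.1⟩
    have hg : Function.Injective g := by
      intro a b hab
      have hab : s(a.1.1, a.1.1 + a.1.2) = s(b.1.1, b.1.1 + b.1.2) := congrArg Subtype.val hab
      rcases Sym2.eq_iff.1 hab with ⟨h, h'⟩ | ⟨h, -⟩
      · refine Subtype.ext (Prod.ext h ?_)
        rw [h] at h'
        exact add_left_cancel h'
      · exact absurd (h ▸ (hQ a).1) (hQ b).2.2.1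
    have hgE : Finset.univ.image g ⊆ E := by
      intro e he
      obtain ⟨a, -, rfl⟩ := Finset.mem_image.1 he
      obtain ⟨ha, hv, -, hH, hH'⟩ := hQ a
      exact Finset.mem_filter.2 ⟨mk_mem_edgesTouching _ (hSΛ ha), (mk_mem_edgesIn _).2 ⟨hH, hH'⟩⟩
    -- The two events are independent, and together they make the boundary edge pivotal.
    have hpiv (a : Q) : μ.real (interiorEq Λ S) * μ.real {ω | (within ω S).Reachable 0 a.1.1} ≤
        μ.real (interiorEq Λ S ∩ pivotal Λ 0 (g a)) := by
      rw [← percMeasure_inter 0 q (disjoint_compl_left (a := edgesIn (S : Set (Fin d → ℤ))))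
        (dependsOn_interiorEq Λ _) (dependsOn_within (fun G => G.Reachable 0 a.1.1) _)
        (measurableSet_interiorEq Λ _) (measurableSet_reachable _ _ _)]
      refine measureReal_mono (fun ω hω => ⟨hω.1, ?_⟩) (measure_ne_top _ _)
      exact mem_pivotal hω.1 (Finset.mem_coe.2 h0) (hQ a).2.2.1 _ hω.2
    have hflux : boundaryFlux s 0 q 0 S ≤ ∑ a : Q, μ.real {ω | (within ω S).Reachable 0 a.1.1} := by
      rw [Finset.sum_coe_sort Q fun a => μ.real {ω | (within ω S).Reachable 0 a.1},
        Finset.sum_filter, Finset.sum_product, boundaryFlux]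
      refine Finset.sum_le_sum fun y _ => Finset.sum_le_sum fun v _ => ?_
      by_cases hv : y + v ∈ S
      · simp [hv]
      · by_cases hH : y ∈ sublattice d s ∧ y + v ∈ sublattice d s
        · simp only [hv, hH, openProb, not_false_eq_true, and_self, if_true, if_false]
          exact mul_le_of_le_one_left measureReal_nonneg q.2.2
        · simp [hv, hH, openProb]
    calc μ.real (interiorEq Λ S) ≤ μ.real (interiorEq Λ S) *
          ∑ a : Q, μ.real {ω | (within ω S).Reachable 0 a.1.1} :=
        le_mul_of_one_le_right measureReal_nonneg ((hq S h0).trans hflux)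
      _ ≤ ∑ a : Q, μ.real (interiorEq Λ S ∩ pivotal Λ 0 (g a)) := by
        rw [Finset.mul_sum]
        exact Finset.sum_le_sum fun a _ => hpiv a
      _ = ∑ e ∈ Finset.univ.image g, μ.real (interiorEq Λ S ∩ pivotal Λ 0 e) :=
        (Finset.sum_image (f := fun e => μ.real (interiorEq Λ S ∩ pivotal Λ 0 e)) hg.injOn).symm
      _ ≤ _ := Finset.sum_le_sum_of_subset_of_nonneg hgE fun _ _ _ => measureReal_nonneg
  -- When the origin does not exit, the set of non-exiting vertices is a subset of `Λ` containing
  -- `0`.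
  have h3 : 1 - μ.real (exits Λ 0) ≤ ∑ S ∈ P, μ.real (interiorEq Λ S) := by
    rw [← probReal_compl_eq_one_sub (measurableSet_exits Λ 0)]
    refine (measureReal_mono (fun ω hω => ?_) (measure_ne_top _ _)).trans
      (measureReal_biUnion_finset_le P _)
    simp only [Set.mem_iUnion]
    have hmem (x : Fin d → ℤ) (hx : ω ∉ exits Λ x) : x ∈ Λ := by
      by_contra hcon
      exact hx (exits_of_notMem hcon ω)
    refine ⟨Λ.filter fun x => ω ∉ exits Λ x, Finset.mem_filter.2 ⟨Finset.mem_powerset.2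
      (Finset.filter_subset _ _), Finset.mem_filter.2 ⟨hmem 0 hω, hω⟩⟩, fun x => ?_⟩
    simp only [Finset.coe_filter]
    exact ⟨fun h => h.2, fun h => ⟨hmem x h, h⟩⟩
  calc _ ≤ _ := h3
    _ ≤ ∑ S ∈ P, ∑ e ∈ E, μ.real (interiorEq Λ S ∩ pivotal Λ 0 e) :=
      Finset.sum_le_sum h2
    _ = ∑ e ∈ E, ∑ S ∈ P, μ.real (interiorEq Λ S ∩ pivotal Λ 0 e) := Finset.sum_comm
    _ ≤ _ := Finset.sum_le_sum fun e _ => h1 e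

/-- Russo's formula, with parameter derivative `1` on edges of `H` and `0` elsewhere, turns the
pivotal count into the differential inequality. -/
lemma exists_hasDerivAt_exits {s : ℕ} (q : I) (Λ : Finset (Fin d → ℤ))
    (hq : ∀ S : Finset (Fin d → ℤ), 0 ∈ S → 1 ≤ boundaryFlux s 0 q 0 S) :
    ∃ f' : ℝ, HasDerivAt (fun t => bernPoly (edgesTouching Λ) (exits Λ 0) (paramVec s 0 t)) f' q ∧
      1 - bernPoly (edgesTouching Λ) (exits Λ 0) (paramVec s 0 q) ≤ f' := by
  classical
  let x' : (lattice d).edgeSet → ℝ := fun e => if e ∈ edgesIn (sublattice d s) then 1 else 0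
  have hx (e : (lattice d).edgeSet) : HasDerivAt (fun t => paramVec s 0 t e) (x' e) q := by
    by_cases he : e ∈ edgesIn (sublattice d s)
    · simpa only [paramVec, x', he, if_true] using hasDerivAt_id' _
    · simpa only [paramVec, x', he, if_false] using hasDerivAt_const _ _
  refine ⟨_, hasDerivAt_bernPoly (edgesTouching Λ) (exits Λ 0)
    (x := fun e t => paramVec s 0 t e) hx, ?_⟩
  have h (e : (lattice d).edgeSet) (b : Bool) :
      (percMeasure d s 0 q).real (setCoord (exits Λ 0) e b) =
      bernPoly (edgesTouching Λ) (setCoord (exits Λ 0) e b) (paramVec s 0 q) :=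
    percMeasure_eq_bernPoly 0 q (dependsOn_setCoord (dependsOn_exits Λ 0) e b)
  have h0 := percMeasure_eq_bernPoly (s := s) 0 q (dependsOn_exits Λ 0)
  have key := one_sub_le_sum_pivotal q Λ hq
  rw [Finset.sum_filter] at key
  simp only [percMeasure_pivotal, h, h0] at key
  refine key.trans (le_of_eq ?_)
  rw [Finset.sum_coe_sort (edgesTouching Λ) fun e => x' e *
    (bernPoly (edgesTouching Λ) (setCoord (exits Λ 0) e true) (paramVec s 0 q) -
      bernPoly (edgesTouching Λ) (setCoord (exits Λ 0) e false) (paramVec s 0 q))]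
  exact Finset.sum_congr rfl fun e _ => by simp [x']

/-- The inequality `f' ≥ 1 - f` makes `(1 - f t) * exp t` nonincreasing, and `f q₀ ≥ 0`. The bound
does not depend on `Λ`, so it survives letting the box grow. -/
lemma one_sub_exp_le_percMeasure_exits {s : ℕ} {q₀ q₁ : I} (h01 : q₀ ≤ q₁)
    (hq : ∀ q ∈ Set.Icc q₀ q₁, ∀ S : Finset (Fin d → ℤ), 0 ∈ S → 1 ≤ boundaryFlux s 0 q 0 S)
    (Λ : Finset (Fin d → ℤ)) :
    1 - Real.exp (q₀ - q₁) ≤ (percMeasure d s 0 q₁).real (exits Λ 0) := by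
  let f : ℝ → ℝ := fun t => bernPoly (edgesTouching Λ) (exits Λ 0) (paramVec s 0 t)
  have hf (q : I) : (percMeasure d s 0 q).real (exits Λ 0) = f q :=
    percMeasure_eq_bernPoly 0 q (dependsOn_exits Λ 0)
  have hd (t : ℝ) (ht : t ∈ Set.Icc (q₀ : ℝ) q₁) :
      ∃ f' : ℝ, HasDerivAt f f' t ∧ 1 - f t ≤ f' :=
    exists_hasDerivAt_exits (⟨t, q₀.2.1.trans ht.1, ht.2.trans q₁.2.2⟩ : I) Λ (hq _ ht)
  have hd' (t : ℝ) (ht : t ∈ Set.Icc (q₀ : ℝ) q₁) :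
      ∃ g' : ℝ, HasDerivAt (fun t => (1 - f t) * Real.exp t) g' t ∧ g' ≤ 0 := by
    obtain ⟨f', hf', hle⟩ := hd t ht
    refine ⟨_, (hf'.const_sub 1).mul (Real.hasDerivAt_exp t), ?_⟩
    nlinarith [Real.exp_pos t]
  have hanti : AntitoneOn (fun t => (1 - f t) * Real.exp t) (Set.Icc (q₀ : ℝ) q₁) := by
    refine antitoneOn_of_deriv_nonpos (convex_Icc _ _) (fun t ht => ?_) (fun t ht => ?_)
      fun t ht => ?_
    · obtain ⟨g', hg', -⟩ := hd' t ht
      exact hg'.continuousAt.continuousWithinAt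
    · obtain ⟨g', hg', -⟩ := hd' t (interior_subset ht)
      exact hg'.differentiableAt.differentiableWithinAt
    · obtain ⟨g', hg', hle⟩ := hd' t (interior_subset ht)
      exact hg'.deriv.trans_le hle
  have h : (1 - f q₁) * Real.exp q₁ ≤ (1 - f q₀) * Real.exp q₀ :=
    hanti (Set.left_mem_Icc.2 h01) (Set.right_mem_Icc.2 h01) h01
  have h0 : 0 ≤ f q₀ := by
    rw [← hf]
    exact measureReal_nonneg
  have h2 : (1 - f q₁) * Real.exp q₁ ≤ Real.exp q₀ := by
    nlinarith [Real.exp_pos q₀]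
  rw [hf, Real.exp_sub]
  have := (le_div_iff₀ (Real.exp_pos _)).2 h2
  linarith

/-- If all boundary fluxes of the origin are at least `1` throughout a nondegenerate interval of
parameters, then there is percolation at the upper end of the interval. -/
lemma percMeasure_percolates_ne_zero {s : ℕ} {q₀ q₁ : I} (h01 : q₀ < q₁)
    (hq : ∀ q ∈ Set.Icc q₀ q₁, ∀ S : Finset (Fin d → ℤ), 0 ∈ S → 1 ≤ boundaryFlux s 0 q 0 S) :
    percMeasure d s 0 q₁ (percolates 0) ≠ 0 := by
  let Λ : ℕ → Finset (Fin d → ℤ) := fun n => Finset.Icc (fun _ => -(n : ℤ)) fun _ => (n : ℤ)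
  have hanti : Antitone fun n => exits (Λ n) 0 := by
    refine fun m n hmn ω ⟨v, hv, hr⟩ => ⟨v, fun hm => hv ?_, hr⟩
    obtain ⟨h1, h2⟩ := Finset.mem_Icc.1 hm
    have hmn' : (m : ℤ) ≤ n := Int.ofNat_le.2 hmn
    exact Finset.mem_Icc.2 ⟨fun i => (neg_le_neg hmn').trans (h1 i), fun i => (h2 i).trans hmn'⟩
  have htend := tendsto_measure_iInter_atTop (μ := percMeasure d s 0 q₁)
    (fun n => (measurableSet_exits (Λ n) 0).nullMeasurableSet) hanti ⟨0, measure_ne_top _ _⟩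
  rw [← percolates_eq_iInter] at htend
  have hpos : 0 < 1 - Real.exp (q₀ - q₁) := by
    have : (q₀ : ℝ) < q₁ := h01
    rw [sub_pos, Real.exp_lt_one_iff]
    linarith
  have hle : ENNReal.ofReal (1 - Real.exp (q₀ - q₁)) ≤ percMeasure d s 0 q₁ (percolates 0) := by
    refine ge_of_tendsto' htend fun n => ?_
    refine ENNReal.ofReal_le_of_le_toReal ?_
    exact one_sub_exp_le_percMeasure_exits h01.le hq (Λ n)
  exact ((ENNReal.ofReal_pos.2 hpos).trans_le hle).ne'

end Supercritical

/-! ### Invariance under translations along `H`. -/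

section Translation

variable {d : ℕ}

lemma lattice_adj_add_left (a : Fin d → ℤ) {y z : Fin d → ℤ} :
    (lattice d).Adj (a + y) (a + z) ↔ (lattice d).Adj y z := by
  simp [lattice]

/-- Translation of edges by `a`. -/
def shiftEdge (a : Fin d → ℤ) (e : (lattice d).edgeSet) : (lattice d).edgeSet :=
  ⟨Sym2.map (a + ·) e, by
    obtain ⟨e, he⟩ := e
    induction e using Sym2.ind with
    | _ y z => exact (lattice_adj_add_left a).2 he⟩

lemma shiftEdge_injective (a : Fin d → ℤ) : Function.Injective (shiftEdge a) := fun _ _ h =>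
  Subtype.ext (Sym2.map.injective (add_right_injective a) (congrArg Subtype.val h))

/-- Translation of configurations by `a`. -/
def shift (a : Fin d → ℤ) (ω : Config d) : Config d := fun e => ω (shiftEdge a e)

lemma add_mem_sublattice_iff {s : ℕ} {a : Fin d → ℤ} (ha : a ∈ sublattice d s) {y : Fin d → ℤ} :
    a + y ∈ sublattice d s ↔ y ∈ sublattice d s := by
  refine forall₂_congr fun i hi => ?_
  rw [Pi.add_apply, ha i hi, zero_add]

lemma openProb_add {s : ℕ} {a : Fin d → ℤ} (ha : a ∈ sublattice d s) (p q : ℝ)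
    (y z : Fin d → ℤ) : openProb s p q (a + y) (a + z) = openProb s p q y z := by
  unfold openProb
  have h := and_congr (add_mem_sublattice_iff ha (y := y)) (add_mem_sublattice_iff ha (y := z))
  by_cases hyz : y ∈ sublattice d s ∧ z ∈ sublattice d s
  · rw [if_pos hyz, if_pos (h.2 hyz)]
  · rw [if_neg hyz, if_neg fun h' => hyz (h.1 h')]

lemma percMeasure_map_shift {s : ℕ} {a : Fin d → ℤ} (ha : a ∈ sublattice d s) (p q : I) :
    (percMeasure d s p q).map (shift a) = percMeasure d s p q := by
  refine (Measure.map_infinitePi_infinitePi_of_inj (shiftEdge_injective a)).trans ?_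
  have h (e : (lattice d).edgeSet) : edgeProb d s p q (shiftEdge a e) = edgeProb d s p q e := by
    obtain ⟨e, he⟩ := e
    induction e using Sym2.ind with
    | _ y z =>
      refine Subtype.ext ?_
      have he' : (lattice d).Adj y z := he
      rw [edgeProb_mk p q he', ← openProb_add ha]
      exact edgeProb_mk p q ((lattice_adj_add_left a).2 he')
  simp only [h]
  rfl

lemma measurable_shift (a : Fin d → ℤ) : Measurable (shift a) :=
  measurable_pi_lambda _ fun _ => measurable_pi_apply _

lemma openGraph_shift_adj (a : Fin d → ℤ) (ω : Config d) {y z : Fin d → ℤ} :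
    (openGraph (shift a ω)).Adj y z ↔ (openGraph ω).Adj (a + y) (a + z) := by
  simp only [openGraph_adj]
  exact ⟨fun ⟨h, h'⟩ => ⟨(lattice_adj_add_left a).2 h, h'⟩,
    fun ⟨h, h'⟩ => ⟨(lattice_adj_add_left a).1 h, h'⟩⟩

lemma within_shift_reachable (a : Fin d → ℤ) (ω : Config d) (S : Finset (Fin d → ℤ))
    {x y : Fin d → ℤ} : (within (shift a ω) S).Reachable x y ↔
      (within ω (S.map (addLeftEmbedding a))).Reachable (a + x) (a + y) := by
  let φ : within (shift a ω) S ≃g within ω (S.map (addLeftEmbedding a)) :=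
    { toEquiv := Equiv.addLeft a
      map_rel_iff' := by
        intro y z
        refine and_congr (openGraph_shift_adj a ω).symm (and_congr ?_ ?_) <;> simp }
  exact φ.reachable_iff.symm

/-- Translations by vectors of `H` preserve the law, so one finite set found at the origin serves
every vertex of `H`. -/
lemma boundaryFlux_map {s : ℕ} {a : Fin d → ℤ} (ha : a ∈ sublattice d s) (p q : I)
    (S : Finset (Fin d → ℤ)) :
    boundaryFlux s p q a (S.map (addLeftEmbedding a)) = boundaryFlux s p q 0 S := by
  unfold boundaryFlux
  rw [Finset.sum_map]
  refine Finset.sum_congr rfl fun y _ => Finset.sum_congr rfl fun v _ => ?_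
  have h1 : (percMeasure d s p q).real {ω | (within ω S).Reachable 0 y} =
      (percMeasure d s p q).real
        {ω | (within ω (S.map (addLeftEmbedding a))).Reachable a (a + y)} := by
    conv_lhs => rw [← percMeasure_map_shift ha p q]
    rw [map_measureReal_apply (measurable_shift a) (measurableSet_reachable _ _ _)]
    congr 1
    ext ω
    exact (within_shift_reachable a ω S).trans (by rw [add_zero]; rfl)
  rw [h1]
  simp only [addLeftEmbedding_apply, add_assoc, openProb_add ha]
  have h2 : a + (y + v) ∈ S.map (addLeftEmbedding a) ↔ y + v ∈ S := by simp
  simp only [h2]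

end Translation

/-! ### Semicontinuity of the critical parameter at `0`. -/

section Continuity

variable {d s : ℕ}

lemma continuous_boundaryFlux (q : I) (x : Fin d → ℤ) (S : Finset (Fin d → ℤ)) :
    Continuous fun p : I => boundaryFlux s p q x S := by
  unfold boundaryFlux
  refine continuous_finsetSum _ fun y _ => continuous_finsetSum _ fun v _ => ?_
  split_ifs
  · exact continuous_const
  · refine Continuous.mul ?_ ?_
    · unfold openProb
      split_ifs <;> fun_prop
    · have h (p : I) : (percMeasure d s p q).real {ω | (within ω S).Reachable x y} =
          bernPoly (edgesTouching S) {ω | (within ω S).Reachable x y} (paramVec s p q) :=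
        percMeasure_eq_bernPoly p q ((dependsOn_within (fun G => G.Reachable x y) _).mono
          (edgesIn_subset_edgesTouching S))
      simp only [h]
      refine (continuous_bernPoly _ _).comp (continuous_pi fun e => ?_)
      unfold paramVec
      split_ifs <;> fun_prop

lemma boundaryFlux_singleton_le {x : Fin d → ℤ} (hx : x ∉ sublattice d s) (p q : I) :
    boundaryFlux s p q x {x} ≤ (unitVectors d).card * p := by
  rw [boundaryFlux, Finset.sum_singleton, ← nsmul_eq_mul]
  refine Finset.sum_le_card_nsmul _ _ _ fun v _ => ?_
  split_ifs
  · exact p.2.1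
  · simp only [openProb, hx, false_and, if_false]
    exact mul_le_of_le_one_right p.2.1 measureReal_le_one

/-- A boundary flux below `1` in the defect model rules out percolation also for small positive
densities of the bulk edges. -/
lemma eventually_percMeasure_percolates_eq_zero {q : I} {S : Finset (Fin d → ℤ)} (h0 : 0 ∈ S)
    (hS : boundaryFlux s 0 q 0 S < 1) :
    ∀ᶠ p in nhds (0 : I), percMeasure d s p q (percolates 0) = 0 := by
  -- The `1/2` only ensures `c > 0`, so that the singleton bound, a multiple of `p`, drops below `c`
  -- near `p = 0`.
  obtain ⟨c, hc, hc1⟩ := exists_between (max_lt hS one_half_lt_one)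
  have e1 : ∀ᶠ p in nhds (0 : I), boundaryFlux s p q 0 S < c :=
    (continuous_boundaryFlux q 0 S).continuousAt.eventually_lt_const ((le_max_left _ _).trans_lt hc)
  have hcont : Continuous fun p : I => ((unitVectors d).card : ℝ) * p := by fun_prop
  have e2 : ∀ᶠ p : I in nhds 0, ((unitVectors d).card : ℝ) * p < c := by
    refine hcont.continuousAt.eventually_lt_const ?_
    have := (le_max_right _ _).trans_lt hc
    simp only [Set.Icc.coe_zero, mul_zero]
    linarith
  filter_upwards [e1, e2] with p h1 h2
  refine percMeasure_percolates_eq_zero hc1 (fun x => ?_) 0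
  by_cases hx : x ∈ sublattice d s
  · refine ⟨S.map (addLeftEmbedding x), ?_, (boundaryFlux_map hx p q S).trans_le h1.le⟩
    exact Finset.mem_map.2 ⟨0, h0, add_zero x⟩
  · exact ⟨{x}, Finset.mem_singleton_self x, (boundaryFlux_singleton_le hx p q).trans h2.le⟩

/-- Percolation inside `H` has the same probability for every `p`, and at `p = 0` almost surely
there are no other open edges to use. -/
lemma percMeasure_zero_percolates_eq_zero {p q : I}
    (h : percMeasure d s p q (percolates 0) = 0) : percMeasure d s 0 q (percolates 0) = 0 := by
  have hB : percMeasure d s 0 q (percolatesIn (sublattice d s) 0) = 0 := by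
    rw [← measure_mono_null (percolatesIn_subset (sublattice d s) 0) h]
    refine bern_congr (T := edgesIn (sublattice d s)) (fun e he => ?_)
      (dependsOn_percolatesIn _ _) (measurableSet_percolatesIn _ _)
    exact Subtype.ext (by simp [coe_edgeProb, paramVec, he])
  have hopen : ∀ᵐ ω ∂(percMeasure d s 0 q), ∀ e ∉ edgesIn (sublattice d s), ω e = false := by
    refine ae_all_iff.2 fun e => ?_
    by_cases he : e ∈ edgesIn (sublattice d s)
    · simp [he]
    have h0 : edgeProb d s 0 q e = 0 := Subtype.ext (by simp [coe_edgeProb, paramVec, he])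
    have hmap : (percMeasure d s 0 q).map (fun ω => ω e) = Measure.dirac false := by
      rw [percMeasure, Measure.infinitePi_map_eval, h0, bernoulliMeasure_zero]
    have : ∀ᵐ b ∂((percMeasure d s 0 q).map fun ω => ω e), b = false := by
      rw [hmap, ae_dirac_eq]
      rfl
    filter_upwards [ae_of_ae_map (measurable_pi_apply e).aemeasurable this] with ω hω _
    exact hω
  refine measure_mono_null_ae ?_ hB
  filter_upwards [hopen] with ω hω hperc
  have : openGraph ω ≤ within ω (sublattice d s) := fun y z hyz => by
    refine ⟨hyz, ?_⟩
    obtain ⟨hl, ho⟩ := openGraph_adj.1 hyz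
    by_contra hcon
    rw [hω _ fun h' => hcon ((mk_mem_edgesIn hl).1 h')] at ho
    exact Bool.false_ne_true ho
  exact Set.Infinite.mono (fun v hv => SimpleGraph.Reachable.mono this hv) hperc

lemma bddAbove_criticalParam (d s : ℕ) (p : I) :
    BddAbove {x : ℝ | ∃ q : I, (q : ℝ) = x ∧ percMeasure d s p q (percolates 0) = 0} := by
  refine ⟨1, ?_⟩
  rintro x ⟨q, rfl, -⟩
  exact q.2.2

lemma criticalParam_le_zero (d s : ℕ) (p : I) : criticalParam d s p ≤ criticalParam d s 0 := by
  refine Real.sSup_le ?_ (criticalParam_mem d s 0).1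
  rintro x ⟨q, rfl, hq⟩
  exact le_csSup (bddAbove_criticalParam d s 0) ⟨q, rfl, percMeasure_zero_percolates_eq_zero hq⟩

lemma eventually_lt_criticalParam {a : ℝ} (ha : a < criticalParam d s 0) :
    ∀ᶠ p in nhds (0 : I), a < criticalParam d s p := by
  rcases lt_or_ge a 0 with ha0 | ha0
  · exact Filter.Eventually.of_forall fun p => ha0.trans_le (criticalParam_mem d s p).1
  -- With `a ≥ 0`, the convention that the empty supremum is `0` does no harm.
  obtain ⟨_, ⟨q₁, rfl, hq₁⟩, haq⟩ : ∃ x ∈ {x : ℝ | ∃ q : I, (q : ℝ) = x ∧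
      percMeasure d s 0 q (percolates 0) = 0}, a < x := by
    by_contra! hcon
    exact (Real.sSup_le hcon ha0).not_gt ha
  obtain ⟨b, hab, hbq⟩ := exists_between haq
  let q₀ : I := ⟨b, ha0.trans hab.le, hbq.le.trans q₁.2.2⟩
  have h01 : q₀ < q₁ := hbq
  -- Since `t ≥ b > a`, this `t` itself witnesses the lower bound; monotonicity in `q` is never
  -- invoked.
  obtain ⟨t, ht, S, h0, hS⟩ : ∃ t ∈ Set.Icc q₀ q₁, ∃ S : Finset (Fin d → ℤ), 0 ∈ S ∧
      boundaryFlux s 0 t 0 S < 1 := by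
    by_contra! hcon
    exact percMeasure_percolates_ne_zero h01 hcon hq₁
  filter_upwards [eventually_percMeasure_percolates_eq_zero h0 hS] with p hp
  have hbt : b ≤ t := ht.1
  exact hab.trans_le (hbt.trans (le_csSup (bddAbove_criticalParam d s p) ⟨t, rfl, hp⟩))

end Continuity

end DefectPercolation

theorem mainTheorem4 (d s : ℕ) (hs : 1 ≤ s) (hsd : s ≤ d) :
    ContinuousAt (fun p : unitInterval => DefectPercolation.criticalParam d s p) 0 := by
  refine tendsto_order.2 ⟨fun a ha => DefectPercolation.eventually_lt_criticalParam ha,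
    fun a ha => Filter.Eventually.of_forall fun p => ?_⟩
  exact (DefectPercolation.criticalParam_le_zero d s p).trans_lt ha
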